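/- Let $n\ge 1$, let $E$ be an Archimedean vector lattice (over $\mathbb R$), let $f_1,\dots,f_n\in E$, and let $h\colon\mathbb R^n\to\mathbb R$ be continuous and positively homogeneous, i.e. $h(\lambda x)=\lambda h(x)$ for all $\lambda\ge 0$, $x\in\mathbb R^n$. A map $\phi\colon\mathbb R^n\to\mathbb R$ is sublinear (superlinear) if it is positively homogeneous and subadditive (superadditive). Continuous calculus (Buskes, de Pagter, van Rooij). We say that $(c)\text{-}h(f_1,\dots,f_n)$ is defined in $E$, with value $g\in E$, if $h(\omega(f_1),\dots,\omega(f_n))=\omega(g)$ for every real-valued vector lattice homomorphism $\omega$ on the vector sublattice of $E$ generated by $f_1,\dots,f_n,g$. Semicontinuous calculus. For a sublinear map $\phi$, put $\underline\partial\phi=\{a\in\mathbb R^n:\sum_i a_ix_i\le\phi(x)\text{ for all }x\in\mathbb R^n\}$; we say that $\phi(f_1,\dots,f_n)$ is defined in $E$ if $\phi(f_1,\dots,f_n):=\sup_{a\in\underline\partial\phi}\sum_i a_if_i$ exists in $E$. For a superlinear map $\psi$, put $\overline\partial\psi=\{a\in\mathbb R^n:\sum_i a_ix_i\ge\psi(x)\text{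 for all }x\in\mathbb R^n\}$; we say that $\psi(f_1,\dots,f_n)$ is defined in $E$ if $\psi(f_1,\dots,f_n):=\inf_{a\in\overline\partial\psi}\sum_i a_if_i$ exists in $E$. For a positively homogeneous $k\colon\mathbb R^n\to\mathbb R$ that is bounded on the Euclidean unit sphere, we say that $(s)\text{-}k(f_1,\dots,f_n)$ is defined in $E$, with value $g\in E$, if at least one of the following holds: (U) $k$ is upper semicontinuous and there is a family $\Phi$ of sublinear maps with $k(x)=\inf_{\phi\in\Phi}\phi(x)$ for all $x\in\mathbb R^n$, such that $\phi(f_1,\dots,f_n)$ is defined in $E$ for every $\phi\in\Phi$ and $g=\inf_{\phi\in\Phi}\phi(f_1,\dots,f_n)$ in $E$; (L) $k$ is lower semicontinuous and there is a family $\Psi$ of superlinear maps with $k(x)=\sup_{\psi\in\Psi}\psi(x)$ for all $x\in\mathbb R^n$, such that $\psi(f_1,\dots,f_n)$ is defined in $E$ for every $\psi\in\Psi$ and $g=\sup_{\psi\in\Psi}\psi(f_1,\dots,f_n)$ in $E$. Then $(c)\text{-}h(f_1,\dots,f_n)$ is defined in $E$ if and only if $(s)\text{-}h(f_1,\dots,f_n)$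 is defined in $E$, and in this case the two values coincide: every value $g$ of the former and every value $g'$ of the latter satisfy $g=g'$. -/

import Mathlib

/-- A vector lattice (the ordered real vector space `E`, a lattice) is Archimedean if a positive
element all of whose natural multiples lie below a common bound is zero.
(Mathlib's class `Archimedean` is a different, much stronger condition here.) -/
def IsArchimedeanVL (E : Type*) [AddCommGroup E] [Lattice E] : Prop :=
  ∀ x y : E, 0 ≤ x → (∀ m : ℕ, m • x ≤ y) → x = 0

/-- A vector sublattice: a linear subspace closed under the binary suprema and infima of `E`. -/
structure VectorSublattice (E : Type*) [AddCommGroup E] [Lattice E] [Module ℝ E]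
    extends Submodule ℝ E where
  sup_mem' : ∀ {x y : E}, x ∈ carrier → y ∈ carrier → x ⊔ y ∈ carrier
  inf_mem' : ∀ {x y : E}, x ∈ carrier → y ∈ carrier → x ⊓ y ∈ carrier

/-- The lattice structure that a vector sublattice inherits. -/
instance VectorSublattice.instLattice {E : Type*} [AddCommGroup E] [Lattice E] [Module ℝ E]
    (L : VectorSublattice E) : Lattice L.toSubmodule :=
  Subtype.lattice (fun _ _ hx hy => L.sup_mem' hx hy) (fun _ _ hx hy => L.inf_mem' hx hy)

/-- The vector sublattice of `E` generated by a set: the smallest one that contains it. -/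
def VectorSublattice.generated {E : Type*} [AddCommGroup E] [Lattice E] [Module ℝ E]
    (s : Set E) : VectorSublattice E where
  toSubmodule := sInf {S | ∃ L : VectorSublattice E, s ⊆ L.carrier ∧ S = L.toSubmodule}
  sup_mem' := by
    intro x y hx hy
    simp only [AddSubsemigroup.mem_carrier, AddSubmonoid.mem_toSubsemigroup,
      Submodule.mem_toAddSubmonoid, Submodule.mem_sInf] at hx hy ⊢
    rintro _ ⟨L, hL, rfl⟩
    exact L.sup_mem' (hx _ ⟨L, hL, rfl⟩) (hy _ ⟨L, hL, rfl⟩)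
  inf_mem' := by
    intro x y hx hy
    simp only [AddSubsemigroup.mem_carrier, AddSubmonoid.mem_toSubsemigroup,
      Submodule.mem_toAddSubmonoid, Submodule.mem_sInf] at hx hy ⊢
    rintro _ ⟨L, hL, rfl⟩
    exact L.inf_mem' (hx _ ⟨L, hL, rfl⟩) (hy _ ⟨L, hL, rfl⟩)

theorem VectorSublattice.subset_generated {E : Type*} [AddCommGroup E] [Lattice E] [Module ℝ E]
    {s : Set E} {x : E} (hx : x ∈ s) : x ∈ (VectorSublattice.generated s).toSubmodule := by
  refine Submodule.mem_sInf.2 ?_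
  rintro _ ⟨L, hL, rfl⟩
  exact hL hx

/-- The set `H(F)` of all real-valued vector lattice homomorphisms on `F`. -/
def realLatticeHoms (F : Type*) [AddCommGroup F] [Lattice F] [Module ℝ F] : Set (F →ₗ[ℝ] ℝ) :=
  {ω | ∀ x y : F, ω (x ⊔ y) = ω x ⊔ ω y ∧ ω (x ⊓ y) = ω x ⊓ ω y}

/-- Positive homogeneity of a function on `ℝⁿ`. -/
def PosHomogeneous {n : ℕ} (h : (Fin n → ℝ) → ℝ) : Prop :=
  ∀ c : ℝ, 0 ≤ c → ∀ x : Fin n → ℝ, h (c • x) = c * h x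

/-- Sublinear maps: positively homogeneous and subadditive. -/
def IsSublinearMap {n : ℕ} (φ : (Fin n → ℝ) → ℝ) : Prop :=
  PosHomogeneous φ ∧ ∀ x y : Fin n → ℝ, φ (x + y) ≤ φ x + φ y

/-- Superlinear maps: positively homogeneous and superadditive. -/
def IsSuperlinearMap {n : ℕ} (ψ : (Fin n → ℝ) → ℝ) : Prop :=
  PosHomogeneous ψ ∧ ∀ x y : Fin n → ℝ, ψ x + ψ y ≤ ψ (x + y)

/-- Boundedness on the Euclidean unit sphere of `ℝⁿ`. -/
def BoundedOnUnitSphere {n : ℕ} (h : (Fin n → ℝ) → ℝ) : Prop :=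
  ∃ m M : ℝ, ∀ x : Fin n → ℝ, Real.sqrt (∑ i, x i ^ 2) = 1 → m ≤ h x ∧ h x ≤ M

/-- The subdifferential of `φ` at the origin. -/
def subdifferentialZero {n : ℕ} (φ : (Fin n → ℝ) → ℝ) : Set (Fin n → ℝ) :=
  {a | ∀ x : Fin n → ℝ, ∑ i, a i * x i ≤ φ x}

/-- The superdifferential of `ψ` at the origin. -/
def superdifferentialZero {n : ℕ} (ψ : (Fin n → ℝ) → ℝ) : Set (Fin n → ℝ) :=
  {a | ∀ x : Fin n → ℝ, ψ x ≤ ∑ i, a i * x i}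

/-- For a sublinear map `φ`: the value `φ(f₁,…,fₙ)` is defined in `E` and equals `u`, that is,
`u` is the supremum in `E` of the elements `∑ aᵢ fᵢ` over `a` in the subdifferential of `φ`. -/
def IsSublinearValue {E : Type*} [AddCommGroup E] [Lattice E] [Module ℝ E] {n : ℕ}
    (φ : (Fin n → ℝ) → ℝ) (f : Fin n → E) (u : E) : Prop :=
  IsLUB ((fun a : Fin n → ℝ => ∑ i, a i • f i) '' subdifferentialZero φ) u

/-- For a superlinear map `ψ`: the value `ψ(f₁,…,fₙ)` is defined in `E` and equals `u`, that is,
`u` is the infimum in `E` of the elements `∑ aᵢ fᵢ` over `a` in the superdifferential of `ψ`. -/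
def IsSuperlinearValue {E : Type*} [AddCommGroup E] [Lattice E] [Module ℝ E] {n : ℕ}
    (ψ : (Fin n → ℝ) → ℝ) (f : Fin n → E) (u : E) : Prop :=
  IsGLB ((fun a : Fin n → ℝ => ∑ i, a i • f i) '' superdifferentialZero ψ) u

/-- `Φ` gives an inf-sublinear representation of `h`. (As the infimum is that of `ℝ`,
such a family is not empty.) -/
def IsInfSublinearRep {n : ℕ} (Φ : Set ((Fin n → ℝ) → ℝ)) (h : (Fin n → ℝ) → ℝ) : Prop :=
  (∀ φ ∈ Φ, IsSublinearMap φ) ∧ ∀ x : Fin n → ℝ, IsGLB ((fun φ => φ x) '' Φ) (h x)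

/-- `Ψ` gives a sup-superlinear representation of `h`. -/
def IsSupSuperlinearRep {n : ℕ} (Ψ : Set ((Fin n → ℝ) → ℝ)) (h : (Fin n → ℝ) → ℝ) : Prop :=
  (∀ ψ ∈ Ψ, IsSuperlinearMap ψ) ∧ ∀ x : Fin n → ℝ, IsLUB ((fun ψ => ψ x) '' Ψ) (h x)

/-- The value `h(f₁,…,fₙ)` of the continuous calculus (Buskes, de Pagter, van Rooij) is defined
in `E` and equals `g`: `h(ω(f₁),…,ω(fₙ)) = ω(g)` for every real-valued vector lattice homomorphism
`ω` on the vector sublattice generated by `f₁,…,fₙ,g`. -/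
def IsContinuousCalculusValue {E : Type*} [AddCommGroup E] [Lattice E] [Module ℝ E] {n : ℕ}
    (h : (Fin n → ℝ) → ℝ) (f : Fin n → E) (g : E) : Prop :=
  Continuous h ∧ PosHomogeneous h ∧
    ∀ ω ∈ realLatticeHoms (VectorSublattice.generated (insert g (Set.range f))).toSubmodule,
      h (fun i => ω ⟨f i, VectorSublattice.subset_generated (Or.inr ⟨i, rfl⟩)⟩) =
        ω ⟨g, VectorSublattice.subset_generated (Or.inl rfl)⟩

/-- The upper semicontinuous case of the semicontinuous calculus: for some inf-sublinear
representation `Φ` of `h`, every `φ(f₁,…,fₙ)`, `φ ∈ Φ`, is defined in `E`, and their infimum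
exists in `E` and equals `g`. -/
def IsUpperCalculusValue {E : Type*} [AddCommGroup E] [Lattice E] [Module ℝ E] {n : ℕ}
    (h : (Fin n → ℝ) → ℝ) (f : Fin n → E) (g : E) : Prop :=
  UpperSemicontinuous h ∧ PosHomogeneous h ∧ BoundedOnUnitSphere h ∧
    ∃ Φ : Set ((Fin n → ℝ) → ℝ), IsInfSublinearRep Φ h ∧
      (∀ φ ∈ Φ, ∃ u : E, IsSublinearValue φ f u) ∧
      IsGLB {u : E | ∃ φ ∈ Φ, IsSublinearValue φ f u} g

/-- The lower semicontinuous case of the semicontinuous calculus: for some sup-superlinear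
representation `Ψ` of `h`, every `ψ(f₁,…,fₙ)`, `ψ ∈ Ψ`, is defined in `E`, and their supremum
exists in `E` and equals `g`. -/
def IsLowerCalculusValue {E : Type*} [AddCommGroup E] [Lattice E] [Module ℝ E] {n : ℕ}
    (h : (Fin n → ℝ) → ℝ) (f : Fin n → E) (g : E) : Prop :=
  LowerSemicontinuous h ∧ PosHomogeneous h ∧ BoundedOnUnitSphere h ∧
    ∃ Ψ : Set ((Fin n → ℝ) → ℝ), IsSupSuperlinearRep Ψ h ∧
      (∀ ψ ∈ Ψ, ∃ u : E, IsSuperlinearValue ψ f u) ∧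
      IsLUB {u : E | ∃ ψ ∈ Ψ, IsSuperlinearValue ψ f u} g

/-- The value `h(f₁,…,fₙ)` of the semicontinuous calculus is defined in `E` and equals `g`. -/
def IsSemicontinuousCalculusValue {E : Type*} [AddCommGroup E] [Lattice E] [Module ℝ E] {n : ℕ}
    (h : (Fin n → ℝ) → ℝ) (f : Fin n → E) (g : E) : Prop :=
  IsUpperCalculusValue h f g ∨ IsLowerCalculusValue h f g

/-!
A continuous calculus value is characterised by its images under real lattice homomorphisms, a
semicontinuous one by the order of `E`. The two are compared through two facts.

* Real lattice homomorphisms determine the order (`IsArchimedeanVL.exists_sublattice`): finitely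
  many elements of an Archimedean vector lattice lie in a principal ideal, and on the ideal of `e`
  the functional `x ↦ min {c | x ≤ c • e}` is sublinear and maps suprema to maxima. By Zorn's lemma
  such a functional dominates a real lattice homomorphism with the same value at a prescribed point
  (`IsSupSublinear.exists_latticeHom`), because the minimal ones are linear.
* A continuous positively homogeneous `h` is the pointwise infimum of polyhedral sublinear maps
  `p ≥ h`, and by duality the supremum of polyhedral superlinear maps (`exists_majorant`). For
  these, `p(f₁,…,fₙ)` is a lattice-linear expression in `f₁,…,fₙ`, so it exists in every vector
  sublattice containing them and commutes with lattice homomorphisms (`Represents`).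

If `g` is a continuous calculus value, the polyhedral `p ≥ h` form an inf-sublinear representation
whose values have infimum `g`: both bounds are checked under real lattice homomorphisms. Conversely,
let `g` be the infimum of values `φ(f₁,…,fₙ)`, `φ ∈ Φ`. Then `g ≤ p(f₁,…,fₙ)` for all polyhedral
`p ≥ φ ∈ Φ`, and `g ≥ q(f₁,…,fₙ)` for all polyhedral superlinear `q ≤ h`. A homomorphism `ω` on the
sublattice generated by `f₁,…,fₙ, g` can be applied to these inequalities, although it need not be
defined at `φ(f₁,…,fₙ)`, and optimising over `p`, `φ` and `q` gives `ω(g) = h(ω(f₁),…,ω(fₙ))`. The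
lower semicontinuous case follows by negation, and uniqueness from the first fact.
-/

/-! ### Real lattice homomorphisms below a sup-preserving sublinear functional -/

/-- A sublinear functional on a vector lattice that maps binary suprema to maxima. -/
structure IsSupSublinear {F : Type*} [AddCommGroup F] [Lattice F] [Module ℝ F]
    (q : F → ℝ) : Prop where
  smul_le : ∀ c : ℝ, 0 < c → ∀ x, q (c • x) ≤ c * q x
  add_le : ∀ x y, q (x + y) ≤ q x + q y
  sup_eq : ∀ x y, q (x ⊔ y) = max (q x) (q y)

namespace IsSupSublinear

variable {F : Type*} [AddCommGroup F] [Lattice F] [Module ℝ F]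

theorem smul_eq {q : F → ℝ} (hq : IsSupSublinear q) {c : ℝ} (hc : 0 < c) (x : F) :
    q (c • x) = c * q x := by
  refine le_antisymm (hq.smul_le c hc x) ?_
  have h := hq.smul_le c⁻¹ (inv_pos.2 hc) (c • x)
  rw [inv_smul_smul₀ hc.ne'] at h
  calc c * q x ≤ c * (c⁻¹ * q (c • x)) := by gcongr
    _ = q (c • x) := by field_simp

theorem map_zero {q : F → ℝ} (hq : IsSupSublinear q) : q 0 = 0 := by
  have h := hq.smul_eq (c := 2) (by norm_num) 0
  rw [smul_zero] at h
  linarith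

theorem neg_le {q : F → ℝ} (hq : IsSupSublinear q) (x : F) : -q (-x) ≤ q x := by
  have h := hq.add_le x (-x)
  rw [add_neg_cancel, hq.map_zero] at h
  linarith

/-- Infima of downward directed families of sup-preserving functionals preserve suprema.
The members need not be sublinear themselves: the family only has to be so collectively. -/
theorem iInf {ι : Type*} [Nonempty ι] (q : ι → F → ℝ)
    (hbdd : ∀ x, BddBelow (Set.range fun i => q i x))
    (hdir : ∀ i j, ∃ k, q k ≤ q i ∧ q k ≤ q j)
    (hsmul : ∀ c : ℝ, 0 < c → ∀ i x, ∃ k, q k (c • x) ≤ c * q i x)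
    (hadd : ∀ i j x y, ∃ k, q k (x + y) ≤ q i x + q j y)
    (hsup : ∀ i x y, q i (x ⊔ y) = max (q i x) (q i y)) :
    IsSupSublinear fun x => ⨅ i, q i x where
  smul_le c hc x := by
    rw [Real.mul_iInf_of_nonneg hc.le]
    refine le_ciInf fun i => ?_
    obtain ⟨k, hk⟩ := hsmul c hc i x
    exact (ciInf_le (hbdd _) k).trans hk
  add_le x y := by
    refine le_ciInf_add_ciInf fun i j => ?_
    obtain ⟨k, hk⟩ := hadd i j x y
    exact (ciInf_le (hbdd _) k).trans hk
  sup_eq x y := by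
    refine le_antisymm (le_of_forall_pos_lt_add fun ε hε => ?_) (max_le ?_ ?_)
    · obtain ⟨i, hi⟩ := exists_lt_of_ciInf_lt (lt_add_of_pos_right (⨅ i, q i x) hε)
      obtain ⟨j, hj⟩ := exists_lt_of_ciInf_lt (lt_add_of_pos_right (⨅ i, q i y) hε)
      obtain ⟨k, hki, hkj⟩ := hdir i j
      refine (ciInf_le (hbdd _) k).trans_lt ?_
      rw [hsup, ← max_add_add_right]
      exact max_lt_max ((hki x).trans_lt hi) ((hkj y).trans_lt hj)
    · exact le_ciInf fun i => (ciInf_le (hbdd x) i).trans (by rw [hsup]; exact le_max_left _ _)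
    · exact le_ciInf fun i => (ciInf_le (hbdd y) i).trans (by rw [hsup]; exact le_max_right _ _)

/-- The functional is `x ↦ inf_{t ≥ 0} (q (x + t z) - t q z)`. If `q` is the supremum over a compact
set of lattice homomorphisms, this is the supremum over those that attain the value `q z` at `z`. -/
theorem exists_le_neg_le [IsOrderedAddMonoid F] {q : F → ℝ} (hq : IsSupSublinear q) (z : F) :
    ∃ q' : F → ℝ, IsSupSublinear q' ∧ q' ≤ q ∧ q' (-z) ≤ -q z := by
  have hts : ∀ (t : NNReal), q ((t : ℝ) • z) = t * q z := by
    intro t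
    rcases eq_or_lt_of_le t.2 with h | h
    · have h0 : (t : ℝ) = 0 := h.symm
      rw [h0, zero_smul, zero_mul, hq.map_zero]
    · exact hq.smul_eq h z
  let r : NNReal → F → ℝ := fun t x => q (x + (t : ℝ) • z) - t * q z
  have hanti : ∀ s t, r (s + t) ≤ r s := by
    intro s t x
    have h := hq.add_le (x + (s : ℝ) • z) ((t : ℝ) • z)
    rw [hts] at h
    simp only [r, NNReal.coe_add, add_smul, add_mul]
    rw [← add_assoc]
    linarith
  have hbdd : ∀ x, BddBelow (Set.range fun i => r i x) := by
    refine fun x => ⟨-q (-x), ?_⟩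
    rintro _ ⟨t, rfl⟩
    have h := hq.add_le (x + (t : ℝ) • z) (-x)
    rw [add_neg_cancel_comm, hts] at h
    simp only [r]
    linarith
  refine ⟨_, iInf r hbdd (fun i j => ⟨i + j, hanti i j, add_comm i j ▸ hanti j i⟩) ?_ ?_ ?_, ?_, ?_⟩
  · intro c hc t x
    refine ⟨⟨c, hc.le⟩ * t, le_of_eq ?_⟩
    change q (c • x + (c * (t : ℝ)) • z) - c * (t : ℝ) * q z = c * (q (x + (t : ℝ) • z) - t * q z)
    rw [mul_smul, ← smul_add, hq.smul_eq hc]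
    ring
  · intro s t x y
    refine ⟨s + t, ?_⟩
    have h := hq.add_le (x + (s : ℝ) • z) (y + (t : ℝ) • z)
    simp only [r, NNReal.coe_add, add_smul, add_mul]
    rw [add_add_add_comm]
    linarith
  · intro t x y
    simp only [r]
    rw [sup_add, hq.sup_eq, max_sub_sub_right]
  · intro x
    exact (ciInf_le (hbdd x) 0).trans (by simp [r])
  · exact (ciInf_le (hbdd (-z)) 1).trans (by simp [r, hq.map_zero])

/-- The lattice counterpart of the Hahn–Banach theorem: a minimal sup-preserving sublinear
functional is linear, hence a lattice homomorphism. -/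
theorem exists_latticeHom [IsOrderedAddMonoid F] {p : F → ℝ} (hp : IsSupSublinear p) (z : F) :
    ∃ ω ∈ realLatticeHoms F, p z ≤ ω z := by
  -- Every linear functional below `p'` has a value of at least `p z` at `z`.
  obtain ⟨p', hp', -, hp'z⟩ := hp.exists_le_neg_le z
  obtain ⟨q, hqp', hq⟩ := zorn_le_nonempty₀ (α := (F → ℝ)ᵒᵈ)
    {q | IsSupSublinear (OrderDual.ofDual q)} (by
      intro c hcS hc y hy
      have : Nonempty c := ⟨⟨y, hy⟩⟩
      have hdir : ∀ i j : c, ∃ k : c, (OrderDual.ofDual k.1 ≤ OrderDual.ofDual i.1) ∧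
          OrderDual.ofDual k.1 ≤ OrderDual.ofDual j.1 := by
        intro i j
        rcases hc.total i.2 j.2 with h | h
        · exact ⟨j, h, le_rfl⟩
        · exact ⟨i, le_rfl, h⟩
      have hbdd : ∀ x, BddBelow (Set.range fun i : c => OrderDual.ofDual i.1 x) := by
        refine fun x => ⟨-OrderDual.ofDual y (-x), ?_⟩
        rintro _ ⟨i, rfl⟩
        obtain ⟨k, hki, hky⟩ := hdir i ⟨y, hy⟩
        have h1 := (hcS k.2).neg_le x
        have h2 := hki x
        have h3 := hky (-x)
        dsimp only at h1 h2 h3 ⊢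
        linarith
      refine ⟨OrderDual.toDual fun x => ⨅ i : c, OrderDual.ofDual i.1 x,
        iInf _ hbdd hdir (fun a ha i x => ⟨i, (hcS i.2).smul_le a ha x⟩) ?_
          (fun i => (hcS i.2).sup_eq), ?_⟩
      · intro i j x y
        obtain ⟨k, hki, hkj⟩ := hdir i j
        exact ⟨k, ((hcS k.2).add_le x y).trans (add_le_add (hki x) (hkj y))⟩
      · intro q hq x
        exact ciInf_le (hbdd x) ⟨q, hq⟩) (OrderDual.toDual p') hp'
  have hqs : IsSupSublinear (OrderDual.ofDual q) := hq.prop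
  generalize hr : OrderDual.ofDual q = r at hqs
  -- Minimality forces oddness, which turns subadditivity into additivity.
  have hneg : ∀ x, r (-x) = -r x := by
    intro x
    obtain ⟨q', hq', hle, hx⟩ := hqs.exists_le_neg_le x
    have h1 : r ≤ q' := by
      rw [← hr] at hle ⊢
      exact hq.le_of_ge (y := OrderDual.toDual q') hq' hle
    have h2 := h1 (-x)
    have h3 := hqs.neg_le x
    linarith
  have hrp : r ≤ p' := hr ▸ hqp'
  refine ⟨{ toFun := r, map_add' := ?_, map_smul' := ?_ }, ?_, ?_⟩
  · intro x y
    refine le_antisymm (hqs.add_le x y) ?_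
    have h := hqs.add_le (-x) (-y)
    rw [← neg_add, hneg, hneg, hneg] at h
    linarith
  · intro c x
    simp only [RingHom.id_apply, smul_eq_mul]
    rcases lt_trichotomy c 0 with h | rfl | h
    · have h1 := hqs.smul_eq (neg_pos.2 h) x
      rw [neg_smul, hneg] at h1
      linarith
    · rw [zero_smul, hqs.map_zero, zero_mul]
    · exact hqs.smul_eq h x
  · intro x y
    refine ⟨hqs.sup_eq x y, ?_⟩
    change r (x ⊓ y) = min (r x) (r y)
    rw [← neg_neg (x ⊓ y), neg_inf, hneg, hqs.sup_eq, hneg, hneg, max_neg_neg, neg_neg]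
  · change p z ≤ r z
    have h1 := hrp (-z)
    rw [hneg] at h1
    linarith

end IsSupSublinear

/-! ### Real lattice homomorphisms determine the order -/

theorem IsArchimedeanVL.nonpos_of_forall_le_smul {E : Type*} [AddCommGroup E] [Lattice E] [Module ℝ E]
    [IsOrderedModule ℝ E] (hE : IsArchimedeanVL E) {x e : E}
    (he : 0 ≤ e) (h : ∀ ε : ℝ, 0 < ε → x ≤ ε • e) : x ≤ 0 := by
  have hx : x ⊔ 0 = 0 := by
    refine hE (x ⊔ 0) e le_sup_right fun m => ?_
    rcases Nat.eq_zero_or_pos m with rfl | hm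
    · simpa using he
    have hm' : (0 : ℝ) < m := Nat.cast_pos.2 hm
    have h1 : x ⊔ 0 ≤ (m : ℝ)⁻¹ • e :=
      sup_le (h _ (inv_pos.2 hm')) (smul_nonneg (inv_pos.2 hm').le he)
    have h2 := smul_le_smul_of_nonneg_left h1 hm'.le
    rwa [smul_inv_smul₀ hm'.ne', Nat.cast_smul_eq_nsmul] at h2
  exact sup_eq_right.1 hx

section OrderDetermined

variable {E : Type*} [AddCommGroup E] [Lattice E] [IsOrderedAddMonoid E] [Module ℝ E]
  [IsOrderedModule ℝ E]

/-- The real lattice homomorphisms on a sublattice with a strong order unit `e` determine its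
order. The proof applies `IsSupSublinear.exists_latticeHom` to `x ↦ min {c | x ≤ c • e}`. -/
theorem VectorSublattice.le_of_forall_latticeHom_le (hE : IsArchimedeanVL E)
    (L : VectorSublattice E) {e : E} (he : 0 ≤ e) (hL : ∀ x ∈ L.toSubmodule, ∃ c : ℝ, x ≤ c • e)
    (x y : L.toSubmodule) (h : ∀ ω ∈ realLatticeHoms L.toSubmodule, ω x ≤ ω y) :
    (x : E) ≤ y := by
  rcases eq_or_lt_of_le he with he0 | he0
  · obtain ⟨c, hc⟩ := hL _ (x - y).2
    rw [← he0, smul_zero] at hc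
    exact sub_nonpos.1 hc
  let q : L.toSubmodule → ℝ := fun z => sInf {c : ℝ | (z : E) ≤ c • e}
  have hbdd : ∀ z : L.toSubmodule, BddBelow {c : ℝ | (z : E) ≤ c • e} := by
    intro z
    obtain ⟨d, hd⟩ := hL _ (-z).2
    refine ⟨-d, fun c hc => ?_⟩
    by_contra! hcd
    have h1 : 0 ≤ (c + d) • e := by
      rw [add_smul]
      simpa using add_le_add (show _ ≤ c • e from hc) hd
    have h2 := smul_le_smul_of_nonneg_left h1 (inv_pos.2 (show 0 < -(c + d) by linarith)).le
    rw [smul_zero, inv_neg, neg_smul, inv_smul_smul₀ (by linarith), neg_nonneg] at h2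
    exact absurd h2 he0.not_ge
  -- The infimum is attained since `E` is Archimedean.
  have hq : ∀ (z : L.toSubmodule) (c : ℝ), q z ≤ c ↔ (z : E) ≤ c • e := by
    refine fun z c => ⟨fun hz => ?_, fun hz => csInf_le (hbdd z) hz⟩
    refine sub_nonpos.1 (hE.nonpos_of_forall_le_smul he fun ε hε => ?_)
    obtain ⟨d, hd, hdc⟩ := exists_lt_of_csInf_lt (hL _ z.2) (show q z < c + ε by linarith)
    rw [sub_le_iff_le_add, ← add_smul, add_comm]
    exact le_trans hd (smul_le_smul_of_nonneg_right hdc.le he)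
  have hqz : ∀ z : L.toSubmodule, (z : E) ≤ q z • e := fun z => (hq z _).1 le_rfl
  have hsub : IsSupSublinear q := by
    refine ⟨fun c hc z => (hq _ _).2 ?_, fun z w => (hq _ _).2 ?_, fun z w => le_antisymm
      ((hq _ _).2 (sup_le ?_ ?_)) (max_le ((hq _ _).2 ?_) ((hq _ _).2 ?_))⟩
    · rw [mul_smul]
      exact smul_le_smul_of_nonneg_left (hqz z) hc.le
    · rw [add_smul]
      exact add_le_add (hqz z) (hqz w)
    · exact (hqz z).trans (smul_le_smul_of_nonneg_right (le_max_left _ _) he)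
    · exact (hqz w).trans (smul_le_smul_of_nonneg_right (le_max_right _ _) he)
    · exact (le_sup_left : (z : E) ≤ z ⊔ w).trans (hqz (z ⊔ w))
    · exact (le_sup_right : (w : E) ≤ z ⊔ w).trans (hqz (z ⊔ w))
  obtain ⟨ω, hω, hωz⟩ := hsub.exists_latticeHom (x - y)
  have h1 : q (x - y) ≤ 0 := hωz.trans (by rw [map_sub]; exact sub_nonpos.2 (h ω hω))
  have h2 := (hq _ _).1 h1
  rw [zero_smul] at h2
  exact sub_nonpos.1 h2

/-- The order ideal generated by a positive element. -/
def VectorSublattice.principalIdeal (e : E) (he : 0 ≤ e) : VectorSublattice E where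
  carrier := {x | ∃ c : ℝ, |x| ≤ c • e}
  add_mem' := by
    rintro x y ⟨c, hc⟩ ⟨d, hd⟩
    exact ⟨c + d, (abs_add_le x y).trans (by rw [add_smul]; exact add_le_add hc hd)⟩
  zero_mem' := ⟨0, by simp⟩
  smul_mem' := by
    rintro a x ⟨c, hc⟩
    obtain ⟨h1, h2⟩ := abs_le'.1 hc
    have h1 := smul_le_smul_of_nonneg_left h1 (abs_nonneg a)
    have h2 := smul_le_smul_of_nonneg_left h2 (abs_nonneg a)
    refine ⟨|a| * c, abs_le'.2 ?_⟩
    rw [mul_smul]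
    rcases abs_cases a with ⟨h, -⟩ | ⟨h, -⟩ <;> rw [h] at h1 h2 ⊢
    · exact ⟨h1, by rwa [smul_neg] at h2⟩
    · exact ⟨by rwa [neg_smul_neg] at h2, by rwa [neg_smul a x] at h1⟩
  sup_mem' := by
    rintro x y ⟨c, hc⟩ ⟨d, hd⟩
    have hc' := abs_le'.1 (hc.trans (smul_le_smul_of_nonneg_right (le_max_left c d) he))
    have hd' := abs_le'.1 (hd.trans (smul_le_smul_of_nonneg_right (le_max_right c d) he))
    exact ⟨max c d, abs_le'.2 ⟨sup_le hc'.1 hd'.1, by rw [neg_sup]; exact inf_le_left.trans hc'.2⟩⟩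
  inf_mem' := by
    rintro x y ⟨c, hc⟩ ⟨d, hd⟩
    have hc' := abs_le'.1 (hc.trans (smul_le_smul_of_nonneg_right (le_max_left c d) he))
    have hd' := abs_le'.1 (hd.trans (smul_le_smul_of_nonneg_right (le_max_right c d) he))
    exact ⟨max c d, abs_le'.2 ⟨inf_le_left.trans hc'.1, by rw [neg_inf]; exact sup_le hc'.2 hd'.2⟩⟩

/-- Finitely many elements of an Archimedean vector lattice lie in a sublattice whose order is
determined by its real lattice homomorphisms. -/
theorem IsArchimedeanVL.exists_sublattice (hE : IsArchimedeanVL E) {s : Set E} (hs : s.Finite) :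
    ∃ L : VectorSublattice E, (∀ x ∈ s, x ∈ L.toSubmodule) ∧
      ∀ x y : L.toSubmodule, (∀ ω ∈ realLatticeHoms L.toSubmodule, ω x ≤ ω y) → (x : E) ≤ y := by
  have he : 0 ≤ ∑ x ∈ hs.toFinset, |x| := Finset.sum_nonneg fun x _ => abs_nonneg x
  refine ⟨VectorSublattice.principalIdeal _ he, fun x hx => ⟨1, ?_⟩,
    VectorSublattice.le_of_forall_latticeHom_le hE _ he ?_⟩
  · rw [one_smul]
    exact Finset.single_le_sum (f := fun x => |x|) (fun x _ => abs_nonneg x)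
      (hs.mem_toFinset.2 hx)
  · rintro x ⟨c, hc⟩
    exact ⟨c, (le_abs_self x).trans hc⟩

end OrderDetermined

/-! ### Elements that represent a function under all real lattice homomorphisms -/

section Represents

variable {E : Type*} [AddCommGroup E] [Lattice E] [Module ℝ E] {n : ℕ}

/-- The element `u` lies in every vector sublattice `L` that contains `f₁,…,fₙ`, and
`ω(u) = p(ω(f₁),…,ω(fₙ))` for all real lattice homomorphisms `ω` on `L`. -/
def Represents (f : Fin n → E) (p : (Fin n → ℝ) → ℝ) (u : E) : Prop :=
  ∀ (L : VectorSublattice E) (hf : ∀ i, f i ∈ L.toSubmodule), ∃ hu : u ∈ L.toSubmodule,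
    ∀ ω ∈ realLatticeHoms L.toSubmodule, ω ⟨u, hu⟩ = p fun i => ω ⟨f i, hf i⟩

theorem VectorSublattice.sum_smul_mem (L : VectorSublattice E) {f : Fin n → E}
    (hf : ∀ i, f i ∈ L.toSubmodule) (a : Fin n → ℝ) : ∑ i, a i • f i ∈ L.toSubmodule :=
  Submodule.sum_mem _ fun i _ => Submodule.smul_mem _ _ (hf i)

theorem VectorSublattice.map_sum_smul (L : VectorSublattice E) {f : Fin n → E}
    (hf : ∀ i, f i ∈ L.toSubmodule) (a : Fin n → ℝ) (ω : L.toSubmodule →ₗ[ℝ] ℝ) :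
    ω ⟨∑ i, a i • f i, L.sum_smul_mem hf a⟩ = ∑ i, a i * ω ⟨f i, hf i⟩ := by
  have : (⟨∑ i, a i • f i, L.sum_smul_mem hf a⟩ : L.toSubmodule) =
      ∑ i, a i • (⟨f i, hf i⟩ : L.toSubmodule) := Subtype.ext (by simp)
  rw [this, map_sum]
  exact Finset.sum_congr rfl fun i _ => by rw [map_smul, smul_eq_mul]

namespace Represents

variable {f : Fin n → E} {p q : (Fin n → ℝ) → ℝ} {u v : E}

theorem linearMap (f : Fin n → E) (ℓ : (Fin n → ℝ) →ₗ[ℝ] ℝ) : ∃ u, Represents f ℓ u := by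
  refine ⟨∑ i, ℓ (fun j => if i = j then 1 else 0) • f i,
    fun L hf => ⟨L.sum_smul_mem hf _, fun ω _ => ?_⟩⟩
  rw [L.map_sum_smul hf, ℓ.pi_apply_eq_sum_univ]
  exact Finset.sum_congr rfl fun i _ => mul_comm _ _

theorem add (hp : Represents f p u) (hq : Represents f q v) : Represents f (p + q) (u + v) := by
  intro L hf
  obtain ⟨hu, hpu⟩ := hp L hf
  obtain ⟨hv, hqv⟩ := hq L hf
  refine ⟨L.add_mem' hu hv, fun ω hω => ?_⟩
  rw [Pi.add_apply, ← hpu ω hω, ← hqv ω hω, ← map_add]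
  rfl

theorem neg (hp : Represents f p u) : Represents f (-p) (-u) := by
  intro L hf
  obtain ⟨hu, hpu⟩ := hp L hf
  refine ⟨L.toSubmodule.neg_mem hu, fun ω hω => ?_⟩
  rw [Pi.neg_apply, ← hpu ω hω, ← map_neg]
  rfl

theorem sup (hp : Represents f p u) (hq : Represents f q v) : Represents f (p ⊔ q) (u ⊔ v) := by
  intro L hf
  obtain ⟨hu, hpu⟩ := hp L hf
  obtain ⟨hv, hqv⟩ := hq L hf
  refine ⟨L.sup_mem' hu hv, fun ω hω => ?_⟩
  rw [Pi.sup_apply, ← hpu ω hω, ← hqv ω hω, ← (hω _ _).1]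
  rfl

end Represents

/-- Sublinear maps that lattice operations on `f₁,…,fₙ` represent in every sublattice. -/
def IsRepresentedSublinear (f : Fin n → E) (p : (Fin n → ℝ) → ℝ) : Prop :=
  IsSublinearMap p ∧ ∃ u, Represents f p u

namespace IsRepresentedSublinear

variable {f : Fin n → E} {p q : (Fin n → ℝ) → ℝ}

theorem linearMap (f : Fin n → E) (ℓ : (Fin n → ℝ) →ₗ[ℝ] ℝ) : IsRepresentedSublinear f ℓ :=
  ⟨⟨fun c _ x => by simp, fun x y => by simp⟩, Represents.linearMap f ℓ⟩

theorem add (hp : IsRepresentedSublinear f p) (hq : IsRepresentedSublinear f q) :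
    IsRepresentedSublinear f (p + q) := by
  obtain ⟨⟨hp1, hp2⟩, u, hu⟩ := hp
  obtain ⟨⟨hq1, hq2⟩, v, hv⟩ := hq
  refine ⟨⟨fun c hc x => ?_, fun x y => ?_⟩, _, hu.add hv⟩
  · simp only [Pi.add_apply, hp1 c hc, hq1 c hc]
    ring
  · simp only [Pi.add_apply]
    linarith [hp2 x y, hq2 x y]

theorem sup (hp : IsRepresentedSublinear f p) (hq : IsRepresentedSublinear f q) :
    IsRepresentedSublinear f (p ⊔ q) := by
  obtain ⟨⟨hp1, hp2⟩, u, hu⟩ := hp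
  obtain ⟨⟨hq1, hq2⟩, v, hv⟩ := hq
  refine ⟨⟨fun c hc x => ?_, fun x y => ?_⟩, _, hu.sup hv⟩
  · simp only [Pi.sup_apply, hp1 c hc, hq1 c hc]
    exact (mul_max_of_nonneg _ _ hc).symm
  · exact max_le ((hp2 x y).trans (add_le_add (le_max_left _ _) (le_max_left _ _)))
      ((hq2 x y).trans (add_le_add (le_max_right _ _) (le_max_right _ _)))

theorem abs_linearMap (f : Fin n → E) (ℓ : (Fin n → ℝ) →ₗ[ℝ] ℝ) :
    IsRepresentedSublinear f fun x => |ℓ x| :=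
  (linearMap f ℓ).sup (linearMap f (-ℓ))

theorem sum {ι : Type*} (s : Finset ι) {p : ι → (Fin n → ℝ) → ℝ}
    (hp : ∀ i ∈ s, IsRepresentedSublinear f (p i)) : IsRepresentedSublinear f (∑ i ∈ s, p i) :=
  Finset.sum_induction p _ (fun _ _ => add) (linearMap f 0) hp

end IsRepresentedSublinear

end Represents

/-! ### Continuous positively homogeneous functions as infima of represented sublinear maps -/

section Majorant

variable {n : ℕ} {h : (Fin n → ℝ) → ℝ}

theorem PosHomogeneous.map_zero (hh : PosHomogeneous h) : h 0 = 0 := by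
  simpa using hh 0 le_rfl 0

theorem PosHomogeneous.exists_abs_le (hh : PosHomogeneous h) (hc : Continuous h) :
    ∃ B : ℝ, 0 ≤ B ∧ ∀ x, |h x| ≤ B * ‖x‖ := by
  obtain ⟨B, hB⟩ := (isCompact_closedBall (0 : Fin n → ℝ) 1).exists_bound_of_continuousOn
    hc.continuousOn
  refine ⟨B, (norm_nonneg _).trans (hB 0 (by simp)), fun x => ?_⟩
  rcases eq_or_ne x 0 with rfl | hx
  · simp [hh.map_zero]
  have hx' : 0 < ‖x‖ := norm_pos_iff.2 hx
  have h1 := hB (‖x‖⁻¹ • x) (by simp [norm_smul, hx'.ne'])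
  have h2 := hh ‖x‖ hx'.le (‖x‖⁻¹ • x)
  rw [smul_inv_smul₀ hx'.ne'] at h2
  rw [h2, abs_mul, abs_of_pos hx', mul_comm]
  exact mul_le_mul_of_nonneg_right h1 hx'.le

/-- Near the ray through `x₀` the majorant is `c λ(x) + M ‖x - λ(x) x₀‖₁ + N λ(x)⁻`, where
`λ(x₀) = 1` and `c = h(x₀) + ε`: continuity of `h` at `x₀` makes it large enough close to the ray,
and large `M`, `N` take care of the remaining directions. -/
theorem exists_majorant {E : Type*} [AddCommGroup E] [Lattice E] [Module ℝ E] (f : Fin n → E)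
    (hc : Continuous h) (hh : PosHomogeneous h) (x₀ : Fin n → ℝ) {ε : ℝ} (hε : 0 < ε) :
    ∃ p, IsRepresentedSublinear f p ∧ h ≤ p ∧ p x₀ ≤ h x₀ + ε := by
  obtain ⟨B, hB0, hB⟩ := hh.exists_abs_le hc
  have hnorm : ∀ y : Fin n → ℝ, ‖y‖ ≤ ∑ i, |y i| := fun y =>
    (pi_norm_le_iff_of_nonneg (Finset.sum_nonneg fun i _ => abs_nonneg _)).2 fun i =>
      Finset.single_le_sum (f := fun i => |y i|) (fun i _ => abs_nonneg _) (Finset.mem_univ i)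
  rcases eq_or_ne x₀ 0 with rfl | hx₀
  · refine ⟨_, IsRepresentedSublinear.sum Finset.univ fun i _ =>
      IsRepresentedSublinear.abs_linearMap f (B • LinearMap.proj i), fun x => ?_, ?_⟩
    · simp only [Finset.sum_apply, LinearMap.smul_apply, LinearMap.proj_apply, smul_eq_mul,
        abs_mul, abs_of_nonneg hB0, ← Finset.mul_sum]
      exact (le_abs_self _).trans ((hB x).trans (mul_le_mul_of_nonneg_left (hnorm x) hB0))
    · simp [hh.map_zero, hε.le]
  obtain ⟨i₀, hi₀⟩ := Function.ne_iff.1 hx₀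
  rw [Pi.zero_apply] at hi₀
  obtain ⟨δ, hδ, hδh⟩ := Metric.continuous_iff.1 hc x₀ ε hε
  let lam : (Fin n → ℝ) →ₗ[ℝ] ℝ := (x₀ i₀)⁻¹ • LinearMap.proj i₀
  have hlam : lam x₀ = 1 := by simp [lam, hi₀]
  obtain ⟨c, hceq⟩ : ∃ c, c = h x₀ + ε := ⟨_, rfl⟩
  obtain ⟨N, hN⟩ : ∃ N, N = |c| + B * ‖x₀‖ := ⟨_, rfl⟩
  obtain ⟨M, hM⟩ : ∃ M, M = B + N / δ := ⟨_, rfl⟩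
  have hN0 : 0 ≤ N := by rw [hN]; positivity
  have hM0 : 0 ≤ M := by rw [hM]; positivity
  let p : (Fin n → ℝ) → ℝ := fun x =>
    c * lam x + (M * ∑ i, |(x - lam x • x₀) i| + max (-(N * lam x)) 0)
  have hp : IsRepresentedSublinear f p := by
    have h1 := (IsRepresentedSublinear.linearMap f (c • lam)).add
      ((IsRepresentedSublinear.sum Finset.univ fun i _ => IsRepresentedSublinear.abs_linearMap f
        (M • (LinearMap.proj i - x₀ i • lam))).add ((IsRepresentedSublinear.linearMap f
          (-(N • lam))).sup (IsRepresentedSublinear.linearMap f 0)))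
    convert h1 using 1
    funext x
    simp only [p, Pi.add_apply, Finset.sum_apply, LinearMap.smul_apply, LinearMap.proj_apply,
      LinearMap.sub_apply, smul_eq_mul, abs_mul, abs_of_nonneg hM0, Finset.mul_sum, Pi.sup_apply,
      LinearMap.neg_apply, LinearMap.zero_apply, Pi.sub_apply, Pi.smul_apply, mul_comm (lam x)]
  refine ⟨p, hp, fun x => ?_, ?_⟩
  · obtain ⟨y, hy⟩ : ∃ y, y = x - lam x • x₀ := ⟨_, rfl⟩
    obtain ⟨t, ht⟩ : ∃ t, t = lam x := ⟨_, rfl⟩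
    have hxy : x = t • x₀ + y := by rw [hy, ht]; abel
    have hs := hnorm y
    have hbx : h x ≤ B * (|t| * ‖x₀‖ + ‖y‖) := by
      refine (le_abs_self _).trans ((hB x).trans (mul_le_mul_of_nonneg_left ?_ hB0))
      rw [hxy, ← Real.norm_eq_abs, ← norm_smul]
      exact norm_add_le _ _
    simp only [p]
    rw [← hy, ← ht]
    have hMs : M * ‖y‖ ≤ M * ∑ i, |y i| := mul_le_mul_of_nonneg_left hs hM0
    have hct : -(|c| * |t|) ≤ c * t := by rw [← abs_mul]; exact neg_abs_le _
    rcases le_or_gt t 0 with h0 | h0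
    · have h1 : -(N * t) ≤ max (-(N * t)) 0 := le_max_left _ _
      have h2 : B * ‖y‖ ≤ M * ‖y‖ := by
        refine mul_le_mul_of_nonneg_right ?_ (norm_nonneg _)
        rw [hM]
        exact le_add_of_nonneg_right (by positivity)
      have h3 : -(N * t) = |c| * |t| + B * (|t| * ‖x₀‖) := by
        rw [hN, abs_of_nonpos h0]
        ring
      linarith
    · have h1 : 0 ≤ max (-(N * t)) 0 := le_max_right _ _
      rcases lt_or_ge ‖y‖ (t * δ) with h2 | h2
      · have h3 := hδh (x₀ + t⁻¹ • y) (by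
          rw [dist_eq_norm, add_sub_cancel_left, norm_smul, norm_inv, Real.norm_eq_abs,
            abs_of_pos h0]
          exact (inv_mul_lt_iff₀ h0).2 h2)
        have h4 : h x = t * h (x₀ + t⁻¹ • y) := by
          rw [← hh t h0.le, smul_add, smul_inv_smul₀ h0.ne', ← hxy]
        have h5 : h (x₀ + t⁻¹ • y) ≤ c := by
          rw [Real.dist_eq] at h3
          linarith [(abs_lt.1 h3).2]
        have h6 := mul_le_mul_of_nonneg_left h5 h0.le
        have h7 : 0 ≤ M * ‖y‖ := by positivity
        linarith
      · have h3 : N * t ≤ N / δ * ‖y‖ := by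
          rw [div_mul_eq_mul_div, le_div_iff₀ hδ, mul_assoc]
          exact mul_le_mul_of_nonneg_left h2 hN0
        have h4 : M * ‖y‖ = B * ‖y‖ + N / δ * ‖y‖ := by rw [hM]; ring
        have h5 : N * t = |c| * |t| + B * (|t| * ‖x₀‖) := by
          rw [hN, abs_of_pos h0]
          ring
        linarith
  · have h1 : max (-N) 0 = 0 := max_eq_right (by linarith)
    simp [p, hlam, hceq, h1]

end Majorant

/-! ### Sublinear maps on `ℝⁿ` -/

section Sublinear

variable {n : ℕ} {φ : (Fin n → ℝ) → ℝ}

theorem IsSublinearMap.continuous (hφ : IsSublinearMap φ) : Continuous φ := by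
  have h1 : ConvexOn ℝ Set.univ φ := by
    refine ⟨convex_univ, fun x _ y _ a b ha hb _ => ?_⟩
    rw [smul_eq_mul, smul_eq_mul, ← hφ.1 a ha, ← hφ.1 b hb]
    exact hφ.2 _ _
  exact continuousOn_univ.1 (h1.continuousOn isOpen_univ)

/-- Hahn–Banach: a sublinear map is the pointwise maximum over its subdifferential at `0`. -/
theorem IsSublinearMap.exists_subdifferential_eq (hφ : IsSublinearMap φ) (x : Fin n → ℝ) :
    ∃ a ∈ subdifferentialZero φ, ∑ i, a i * x i = φ x := by
  obtain ⟨ℓ, hℓx, hℓ⟩ : ∃ ℓ : (Fin n → ℝ) →ₗ[ℝ] ℝ, ℓ x = φ x ∧ ∀ y, ℓ y ≤ φ y := by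
    have H : ∀ c : ℝ, c • x = 0 → c • φ x = 0 := by
      intro c hc
      rcases smul_eq_zero.1 hc with rfl | rfl
      · simp
      · simp [hφ.1.map_zero]
    obtain ⟨ℓ, h1, h2⟩ := exists_extension_of_le_sublinear
      (LinearPMap.mkSpanSingleton' x (φ x) H) φ (fun c hc => hφ.1 c hc.le) hφ.2 (by
        rintro ⟨y, hy⟩
        obtain ⟨c, rfl⟩ := Submodule.mem_span_singleton.1 hy
        rw [LinearPMap.mkSpanSingleton'_apply]
        simp only [RingHom.id_apply, smul_eq_mul]
        rcases le_or_gt 0 c with hc | hc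
        · exact (hφ.1 c hc x).ge
        · have h3 := hφ.1 (-c) (by linarith) x
          have h4 := hφ.2 (c • x) (-c • x)
          rw [neg_smul, add_neg_cancel, hφ.1.map_zero] at h4
          rw [neg_smul] at h3
          linarith)
    refine ⟨ℓ, ?_, h2⟩
    have h3 := h1 ⟨x, Submodule.mem_span_singleton_self x⟩
    exact h3.trans (LinearPMap.mkSpanSingleton'_apply_self x (φ x) H _)
  have hsum : ∀ y, ∑ i, ℓ (fun j => if i = j then 1 else 0) * y i = ℓ y := fun y => by
    rw [ℓ.pi_apply_eq_sum_univ y]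
    exact Finset.sum_congr rfl fun i _ => mul_comm _ _
  exact ⟨_, fun y => (hsum y).trans_le (hℓ y), (hsum x).trans hℓx⟩

end Sublinear

/-! ### Comparison of the two calculi -/

section Calculus

theorem realLatticeHoms_monotone {F : Type*} [AddCommGroup F] [Lattice F] [Module ℝ F]
    {ω : F →ₗ[ℝ] ℝ} (hω : ω ∈ realLatticeHoms F) {x y : F} (hxy : x ≤ y) : ω x ≤ ω y := by
  have h := (hω x y).1
  rw [sup_eq_right.2 hxy] at h
  exact h ▸ le_sup_left

variable {E : Type*} [AddCommGroup E] [Lattice E] [Module ℝ E] {n : ℕ} {f : Fin n → E}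
  {h φ : (Fin n → ℝ) → ℝ} {g u v : E}

theorem IsContinuousCalculusValue.map_eq (hg : IsContinuousCalculusValue h f g)
    (L : VectorSublattice E) (hfL : ∀ i, f i ∈ L.toSubmodule) (hgL : g ∈ L.toSubmodule)
    {ω : L.toSubmodule →ₗ[ℝ] ℝ} (hω : ω ∈ realLatticeHoms L.toSubmodule) :
    h (fun i => ω ⟨f i, hfL i⟩) = ω ⟨g, hgL⟩ := by
  have hle : (VectorSublattice.generated (insert g (Set.range f))).toSubmodule ≤ L.toSubmodule :=
    sInf_le ⟨L, Set.insert_subset hgL (Set.range_subset_iff.2 hfL), rfl⟩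
  exact hg.2.2 (ω.comp (Submodule.inclusion hle)) fun x y =>
    hω (Submodule.inclusion hle x) (Submodule.inclusion hle y)

theorem IsSublinearValue.le_map (hu : IsSublinearValue φ f u) (hφ : IsSublinearMap φ)
    (L : VectorSublattice E) (hfL : ∀ i, f i ∈ L.toSubmodule) (huL : u ∈ L.toSubmodule)
    {ω : L.toSubmodule →ₗ[ℝ] ℝ} (hω : ω ∈ realLatticeHoms L.toSubmodule) :
    φ (fun i => ω ⟨f i, hfL i⟩) ≤ ω ⟨u, huL⟩ := by
  obtain ⟨a, ha, hax⟩ := hφ.exists_subdifferential_eq fun i => ω ⟨f i, hfL i⟩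
  rw [← hax, ← L.map_sum_smul hfL]
  exact realLatticeHoms_monotone hω (hu.1 ⟨a, ha, rfl⟩)

variable [IsOrderedAddMonoid E]

theorem IsSuperlinearValue.neg (hu : IsSuperlinearValue φ f u) : IsSublinearValue (-φ) f (-u) := by
  have himage : (fun a : Fin n → ℝ => ∑ i, a i • f i) '' subdifferentialZero (-φ) =
      -((fun a : Fin n → ℝ => ∑ i, a i • f i) '' superdifferentialZero φ) := by
    have hmem : ∀ a, a ∈ subdifferentialZero (-φ) ↔ -a ∈ superdifferentialZero φ := fun a =>
      forall_congr' fun x => by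
        simp only [Pi.neg_apply, neg_mul, Finset.sum_neg_distrib]
        exact le_neg
    ext w
    constructor
    · rintro ⟨a, ha, rfl⟩
      exact ⟨-a, (hmem a).1 ha, by simp⟩
    · rintro ⟨a, ha, haw⟩
      refine ⟨-a, (hmem _).2 (by rwa [neg_neg]), ?_⟩
      simp only [Pi.neg_apply, neg_smul, Finset.sum_neg_distrib]
      exact neg_eq_iff_eq_neg.2 haw
  rw [IsSublinearValue, himage, isLUB_neg]
  rwa [neg_neg]

theorem IsLowerCalculusValue.neg (hg : IsLowerCalculusValue h f g) :
    IsUpperCalculusValue (-h) f (-g) := by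
  obtain ⟨hls, hh, ⟨m, M, hmM⟩, Ψ, ⟨hΨ, hsup⟩, hdef, hlub⟩ := hg
  refine ⟨fun x y hy => ?_, fun c hc x => ?_, ⟨-M, -m, fun x hx => ?_⟩, -Ψ,
    ⟨fun φ hφ => ⟨fun c hc x => ?_, fun x y => ?_⟩, fun x => ?_⟩, fun φ hφ => ?_, ?_⟩
  · filter_upwards [hls x (-y) (neg_lt.1 hy)] with z hz using neg_lt.1 hz
  · simp only [Pi.neg_apply, hh c hc, mul_neg]
  · exact ⟨neg_le_neg (hmM x hx).2, neg_le_neg (hmM x hx).1⟩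
  · exact neg_injective (by simpa using (hΨ _ hφ).1 c hc x)
  · have := (hΨ _ hφ).2 x y
    simp only [Pi.neg_apply] at this
    linarith
  · have himage : (fun φ : (Fin n → ℝ) → ℝ => φ x) '' (-Ψ) = -((fun ψ => ψ x) '' Ψ) := by
      ext t
      constructor
      · rintro ⟨φ, hφ, rfl⟩
        exact ⟨-φ, hφ, rfl⟩
      · rintro ⟨ψ, hψ, hψt⟩
        exact ⟨-ψ, by simpa using hψ, neg_eq_iff_eq_neg.2 hψt⟩
    rw [himage]
    exact (hsup x).neg
  · obtain ⟨u, hu⟩ := hdef _ hφ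
    exact ⟨-u, by simpa using hu.neg⟩
  · have hset : {u : E | ∃ φ ∈ -Ψ, IsSublinearValue φ f u} =
        -{u : E | ∃ ψ ∈ Ψ, IsSuperlinearValue ψ f u} := by
      ext u
      constructor
      · rintro ⟨φ, hφ, hu⟩
        obtain ⟨v, hv⟩ := hdef _ hφ
        have hv' : IsSublinearValue φ f (-v) := by simpa using hv.neg
        refine ⟨-φ, hφ, ?_⟩
        rwa [hu.unique hv', neg_neg]
      · rintro ⟨ψ, hψ, hu⟩
        exact ⟨-ψ, by simpa using hψ, by simpa using hu.neg⟩
    rw [hset]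
    exact hlub.neg

variable [IsOrderedModule ℝ E]

theorem IsSublinearValue.le_of_represents (hE : IsArchimedeanVL E) {p : (Fin n → ℝ) → ℝ}
    (hu : IsSublinearValue φ f u) (hv : Represents f p v) (hφp : φ ≤ p) : u ≤ v := by
  refine hu.2 ?_
  rintro _ ⟨a, ha, rfl⟩
  obtain ⟨L, hL, hLle⟩ := hE.exists_sublattice (Set.finite_range f)
  have hfL : ∀ i, f i ∈ L.toSubmodule := fun i => hL _ ⟨i, rfl⟩
  obtain ⟨hvL, hv⟩ := hv L hfL
  refine hLle ⟨_, L.sum_smul_mem hfL a⟩ ⟨v, hvL⟩ fun ω hω => ?_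
  rw [L.map_sum_smul hfL, hv ω hω]
  exact (ha _).trans (hφp _)

theorem Represents.isSublinearValue (hE : IsArchimedeanVL E) (hφ : IsSublinearMap φ)
    (hu : Represents f φ u) : IsSublinearValue φ f u := by
  refine ⟨?_, fun w hw => ?_⟩
  · rintro _ ⟨a, ha, rfl⟩
    obtain ⟨L, hL, hLle⟩ := hE.exists_sublattice (Set.finite_range f)
    have hfL : ∀ i, f i ∈ L.toSubmodule := fun i => hL _ ⟨i, rfl⟩
    obtain ⟨huL, hu⟩ := hu L hfL
    refine hLle ⟨_, L.sum_smul_mem hfL a⟩ ⟨u, huL⟩ fun ω hω => ?_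
    rw [L.map_sum_smul hfL, hu ω hω]
    exact ha _
  · obtain ⟨L, hL, hLle⟩ := hE.exists_sublattice ((Set.finite_range f).insert w)
    have hfL : ∀ i, f i ∈ L.toSubmodule := fun i => hL _ (Or.inr ⟨i, rfl⟩)
    obtain ⟨huL, hu⟩ := hu L hfL
    refine hLle ⟨u, huL⟩ ⟨w, hL _ (Or.inl rfl)⟩ fun ω hω => ?_
    obtain ⟨a, ha, hax⟩ := hφ.exists_subdifferential_eq fun i => ω ⟨f i, hfL i⟩
    rw [hu ω hω, ← hax, ← L.map_sum_smul hfL]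
    exact realLatticeHoms_monotone hω (hw ⟨a, ha, rfl⟩)

theorem IsContinuousCalculusValue.unique (hE : IsArchimedeanVL E) {g' : E}
    (hg : IsContinuousCalculusValue h f g) (hg' : IsContinuousCalculusValue h f g') : g = g' := by
  obtain ⟨L, hL, hLle⟩ := hE.exists_sublattice (((Set.finite_range f).insert g').insert g)
  have hfL : ∀ i, f i ∈ L.toSubmodule := fun i => hL _ (Or.inr (Or.inr ⟨i, rfl⟩))
  have hgL : g ∈ L.toSubmodule := hL _ (Or.inl rfl)
  have hgL' : g' ∈ L.toSubmodule := hL _ (Or.inr (Or.inl rfl))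
  have heq : ∀ ω ∈ realLatticeHoms L.toSubmodule, ω ⟨g, hgL⟩ = ω ⟨g', hgL'⟩ := fun ω hω =>
    (hg.map_eq L hfL hgL hω).symm.trans (hg'.map_eq L hfL hgL' hω)
  exact le_antisymm (hLle ⟨g, hgL⟩ ⟨g', hgL'⟩ fun ω hω => (heq ω hω).le)
    (hLle ⟨g', hgL'⟩ ⟨g, hgL⟩ fun ω hω => (heq ω hω).ge)

theorem Continuous.boundedOnUnitSphere (hc : Continuous h) : BoundedOnUnitSphere h := by
  obtain ⟨B, hB⟩ := (isCompact_closedBall (0 : Fin n → ℝ) 1).exists_bound_of_continuousOn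
    hc.continuousOn
  refine ⟨-B, B, fun x hx => abs_le.1 (hB x ?_)⟩
  rw [mem_closedBall_zero_iff, pi_norm_le_iff_of_nonneg zero_le_one]
  intro i
  rw [Real.sqrt_eq_one] at hx
  rw [Real.norm_eq_abs, ← sq_le_one_iff_abs_le_one, ← hx]
  exact Finset.single_le_sum (f := fun i => x i ^ 2) (fun i _ => sq_nonneg _) (Finset.mem_univ i)

/-- The represented sublinear maps above `h` serve as the representing family. -/
theorem IsContinuousCalculusValue.isUpperCalculusValue (hE : IsArchimedeanVL E)
    (hg : IsContinuousCalculusValue h f g) : IsUpperCalculusValue h f g := by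
  have hc := hg.1
  have hh := hg.2.1
  refine ⟨hc.upperSemicontinuous, hh, hc.boundedOnUnitSphere,
    {φ | IsRepresentedSublinear f φ ∧ h ≤ φ}, ⟨fun φ hφ => hφ.1.1, fun x => ⟨?_, fun b hb => ?_⟩⟩,
    ?_, ?_, fun w hw => ?_⟩
  · rintro _ ⟨φ, hφ, rfl⟩
    exact hφ.2 x
  · refine le_of_forall_pos_le_add fun ε hε => ?_
    obtain ⟨p, hp, hhp, hpx⟩ := exists_majorant f hc hh x hε
    exact (hb ⟨p, ⟨hp, hhp⟩, rfl⟩).trans hpx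
  · rintro φ ⟨⟨hφ, u, hu⟩, -⟩
    exact ⟨u, hu.isSublinearValue hE hφ⟩
  · rintro v ⟨φ, ⟨⟨hφ, u, hu⟩, hhφ⟩, hv⟩
    rw [hv.unique (hu.isSublinearValue hE hφ)]
    obtain ⟨L, hL, hLle⟩ := hE.exists_sublattice ((Set.finite_range f).insert g)
    have hfL : ∀ i, f i ∈ L.toSubmodule := fun i => hL _ (Or.inr ⟨i, rfl⟩)
    have hgL : g ∈ L.toSubmodule := hL _ (Or.inl rfl)
    obtain ⟨huL, hu⟩ := hu L hfL
    refine hLle ⟨g, hgL⟩ ⟨u, huL⟩ fun ω hω => ?_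
    rw [← hg.map_eq L hfL hgL hω, hu ω hω]
    exact hhφ _
  · obtain ⟨L, hL, hLle⟩ := hE.exists_sublattice (((Set.finite_range f).insert g).insert w)
    have hfL : ∀ i, f i ∈ L.toSubmodule := fun i => hL _ (Or.inr (Or.inr ⟨i, rfl⟩))
    have hwL : w ∈ L.toSubmodule := hL _ (Or.inl rfl)
    have hgL : g ∈ L.toSubmodule := hL _ (Or.inr (Or.inl rfl))
    refine hLle ⟨w, hwL⟩ ⟨g, hgL⟩ fun ω hω => ?_
    rw [← hg.map_eq L hfL hgL hω]
    refine le_of_forall_pos_le_add fun ε hε => ?_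
    obtain ⟨p, ⟨hp, u, hu⟩, hhp, hpx⟩ := exists_majorant f hc hh (fun i => ω ⟨f i, hfL i⟩) hε
    obtain ⟨huL, huω⟩ := hu L hfL
    refine le_trans ?_ hpx
    rw [← huω ω hω]
    exact realLatticeHoms_monotone hω
      (hw ⟨p, ⟨⟨hp, u, hu⟩, hhp⟩, hu.isSublinearValue hE hp⟩)

/-- The values `φ(f₁,…,fₙ)` need not lie in `L`, to which `ω` belongs. So `g` is squeezed between
elements that do: those representing sublinear maps above a member of the family, and superlinear
maps below `h`. -/
theorem IsUpperCalculusValue.map_eq (hE : IsArchimedeanVL E) (hc : Continuous h)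
    (hg : IsUpperCalculusValue h f g) (L : VectorSublattice E)
    (hfL : ∀ i, f i ∈ L.toSubmodule) (hgL : g ∈ L.toSubmodule)
    {ω : L.toSubmodule →ₗ[ℝ] ℝ} (hω : ω ∈ realLatticeHoms L.toSubmodule) :
    h (fun i => ω ⟨f i, hfL i⟩) = ω ⟨g, hgL⟩ := by
  obtain ⟨-, hh, -, Φ, ⟨hΦ, hinf⟩, hdef, hglb⟩ := hg
  refine le_antisymm ?_ ((le_isGLB_iff (hinf _)).2 ?_)
  · refine le_of_forall_pos_le_add fun ε hε => ?_
    obtain ⟨p, ⟨-, v, hv⟩, hhp, hpx⟩ := exists_majorant f hc.neg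
      (fun c hc x => by rw [Pi.neg_apply, Pi.neg_apply, hh c hc, mul_neg] : PosHomogeneous (-h))
      (fun i => ω ⟨f i, hfL i⟩) hε
    have hvg : -v ≤ g := by
      refine hglb.2 ?_
      rintro u ⟨φ, hφ, hu⟩
      obtain ⟨M, hM, hMle⟩ := hE.exists_sublattice ((Set.finite_range f).insert u)
      have hfM : ∀ i, f i ∈ M.toSubmodule := fun i => hM _ (Or.inr ⟨i, rfl⟩)
      have huM : u ∈ M.toSubmodule := hM _ (Or.inl rfl)
      obtain ⟨hvM, hvω⟩ := hv.neg M hfM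
      refine hMle ⟨-v, hvM⟩ ⟨u, huM⟩ fun θ hθ => ?_
      rw [hvω θ hθ]
      exact (neg_le.1 (hhp _)).trans (((hinf _).1 ⟨φ, hφ, rfl⟩).trans
        (hu.le_map (hΦ φ hφ) M hfM huM hθ))
    obtain ⟨hvL, hvω⟩ := hv.neg L hfL
    have h1 := realLatticeHoms_monotone hω (show (⟨-v, hvL⟩ : L.toSubmodule) ≤ ⟨g, hgL⟩ from hvg)
    rw [hvω ω hω] at h1
    simp only [Pi.neg_apply] at h1 hpx
    linarith
  · rintro _ ⟨φ, hφ, rfl⟩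
    refine le_of_forall_pos_le_add fun ε hε => ?_
    obtain ⟨p, ⟨-, v, hv⟩, hφp, hpx⟩ := exists_majorant f (hΦ φ hφ).continuous (hΦ φ hφ).1
      (fun i => ω ⟨f i, hfL i⟩) hε
    obtain ⟨u, hu⟩ := hdef φ hφ
    have hgv : g ≤ v := (hglb.1 ⟨φ, hφ, hu⟩).trans (hu.le_of_represents hE hv hφp)
    obtain ⟨hvL, hvω⟩ := hv L hfL
    have h1 := realLatticeHoms_monotone hω (show (⟨g, hgL⟩ : L.toSubmodule) ≤ ⟨v, hvL⟩ from hgv)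
    rw [hvω ω hω] at h1
    exact h1.trans hpx

theorem IsSemicontinuousCalculusValue.isContinuousCalculusValue (hE : IsArchimedeanVL E)
    (hc : Continuous h) (hh : PosHomogeneous h) (hg : IsSemicontinuousCalculusValue h f g) :
    IsContinuousCalculusValue h f g := by
  refine ⟨hc, hh, fun ω hω => ?_⟩
  have hfL : ∀ i, f i ∈ (VectorSublattice.generated (insert g (Set.range f))).toSubmodule :=
    fun i => VectorSublattice.subset_generated (Or.inr ⟨i, rfl⟩)
  have hgL : g ∈ (VectorSublattice.generated (insert g (Set.range f))).toSubmodule :=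
    VectorSublattice.subset_generated (Or.inl rfl)
  rcases hg with hg | hg
  · exact hg.map_eq hE hc _ hfL hgL hω
  · have h1 := hg.neg.map_eq hE hc.neg _ hfL (Submodule.neg_mem _ hgL) hω
    have h2 : ω ⟨-g, Submodule.neg_mem _ hgL⟩ = -ω ⟨g, hgL⟩ := map_neg ω ⟨g, hgL⟩
    rw [h2] at h1
    exact neg_injective h1

end Calculus

theorem corollary6p2 {E : Type*} [AddCommGroup E] [Lattice E] [IsOrderedAddMonoid E]
    [Module ℝ E] [IsOrderedModule ℝ E] (hE : IsArchimedeanVL E)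
    (n : ℕ) (hn : 1 ≤ n) (h : (Fin n → ℝ) → ℝ) (hcont : Continuous h)
    (hhom : PosHomogeneous h) (f : Fin n → E) :
    ((∃ g : E, IsContinuousCalculusValue h f g) ↔
        ∃ g : E, IsSemicontinuousCalculusValue h f g) ∧
      ∀ g g' : E, IsContinuousCalculusValue h f g → IsSemicontinuousCalculusValue h f g' →
        g = g' := by
  refine ⟨⟨fun ⟨g, hg⟩ => ⟨g, Or.inl (hg.isUpperCalculusValue hE)⟩, fun ⟨g, hg⟩ =>
    ⟨g, hg.isContinuousCalculusValue hE hcont hhom⟩⟩, fun g g' hg hg' => ?_⟩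
  exact hg.unique hE (hg'.isContinuousCalculusValue hE hcont hhom)
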